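/- A matrix $M\in\mathbb{R}^{n\times n}$ is called RDDL if $M_{ij}\le 0$ for all $i\ne j$, $M_{ii}>0$ for all $i$, and $|M_{ii}|\ge\sum_{j\ne i}|M_{ij}|$ for all $i$. For a finite directed graph $H$ without loops with edge weights $w$ (the edges being the ordered pairs of nonzero weight) and a vertex $r$, let $$\tau(H,r)=\sum_{F}\ \prod_{e\in F}w_e ,$$ where $F$ runs over all spanning trees of $H$ oriented towards $r$, i.e. sets $F$ of edges such that no edge of $F$ leaves $r$, exactly one edge of $F$ leaves each other vertex, and each vertex has a directed path to $r$ in $F$ (the weighted number of spanning trees of $H$ oriented towards $r$). Let $M\in\mathbb{R}^{n\times n}$ be RDDL. Let $G_M$ be the weighted directed graph on $\{1,\dots,n\}\cup\{\ast\}$, where $\ast$ is a dummy vertex, in which $(k,l)$ has weight $-M_{kl}$ for $k\neq l$ in $\{1,\dots,n\}$, $(k,\ast)$ has weight $\sum_{m=1}^n M_{km}$, and no edge leaves $\ast$. For $i\in\{1,\dots,n\}$, let $G_M^{(i)}$ be the graph on $\{1,\dots,n\}$ obtained from $G_M$ by identifying $\ast$ with $i$: for $k\ne l$, the weight of $(k,l)$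 is $-M_{kl}$ if $l\neq i$, and $-M_{ki}+\sum_{m=1}^n M_{km}$ if $l=i$. **Lemma.** If $M$ is an invertible RDDL matrix, then for all $i,j\in\{1,\dots,n\}$ all edges of $G_M$ and of $G_M^{(i)}$ have positive weights, $\tau(G_M,\ast)>0$, and $$(M^{-1})_{ij}=\frac{\tau\big(G_M^{(i)},\,j\big)}{\tau\big(G_M,\,\ast\big)} .$$ -/

import Mathlib

/-- `M` is an `L`-matrix: nonpositive off-diagonal entries and positive diagonal entries. -/
def IsLMatrix {n : ℕ} (M : Matrix (Fin n) (Fin n) ℝ) : Prop :=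
  (∀ i j, i ≠ j → M i j ≤ 0) ∧ ∀ i, 0 < M i i

/-- `M` is row diagonally dominant. -/
def IsRDD {n : ℕ} (M : Matrix (Fin n) (Fin n) ℝ) : Prop :=
  ∀ i, ∑ j ∈ Finset.univ.erase i, |M i j| ≤ |M i i|

/-- `M` is a row diagonally dominant `L`-matrix. -/
def IsRDDL {n : ℕ} (M : Matrix (Fin n) (Fin n) ℝ) : Prop :=
  IsLMatrix M ∧ IsRDD M

/-- A weighted directed graph without loops on the vertex set `V`. The edges are the ordered pairs
of nonzero weight. -/
structure WeightedDigraph (V : Type*) where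
  weight : V → V → ℝ
  loopless : ∀ v, weight v v = 0

namespace WeightedDigraph

/-- `(u, v)` is an edge of `G`, directed from `u` to `v`. -/
def IsEdge {V : Type*} (G : WeightedDigraph V) (u v : V) : Prop :=
  G.weight u v ≠ 0

/-- All edges of `G` carry positive weights. -/
def HasPositiveWeights {V : Type*} (G : WeightedDigraph V) : Prop :=
  ∀ u v, G.IsEdge u v → 0 < G.weight u v

/-- The set of directed edges `F` is a spanning tree of `G` oriented towards the vertex `r`: no edge
of `F` leaves `r`, exactly one edge of `F` leaves each other vertex, and every vertex has a directed
path to `r` along edges of `F`. -/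
structure IsSpanningTreeTowards {V : Type*} (G : WeightedDigraph V) (r : V)
    (F : Finset (V × V)) : Prop where
  isEdge : ∀ e ∈ F, G.IsEdge e.1 e.2
  root : ∀ v, (r, v) ∉ F
  existsUnique_out : ∀ u, u ≠ r → ∃! v, (u, v) ∈ F
  reaches : ∀ u, Relation.ReflTransGen (fun a b => (a, b) ∈ F) u r

open scoped Classical in
/-- The weighted number of spanning trees of `G` oriented towards `r`: the sum over all such trees
of the product of the weights of their edges. -/
noncomputable def treeCount {V : Type*} [Fintype V] (G : WeightedDigraph V) (r : V) : ℝ :=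
  ∑ F : Finset (V × V) with G.IsSpanningTreeTowards r F, ∏ e ∈ F, G.weight e.1 e.2

end WeightedDigraph

/-- The graph corresponding to the matrix `M`. Its vertices are the indices `some i` together with
the dummy vertex `none`. For `i ≠ j` the weight of `(i, j)` is `-M i j`, the weight of an edge from
`i` to the dummy vertex is the sum of row `i`, and no edge leaves the dummy vertex. -/
noncomputable def matrixGraph {n : ℕ} (M : Matrix (Fin n) (Fin n) ℝ) :
    WeightedDigraph (Option (Fin n)) where
  weight
    | some i, some j => if i = j then 0 else -M i j
    | some i, none => ∑ j, M i j
    | none, _ => 0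
  loopless := by rintro (_ | _) <;> simp

/-- The graph obtained from the graph corresponding to `M` by identifying the dummy vertex with the
vertex `i` (parallel edges are merged, their weights added, and loops are deleted). -/
noncomputable def mergedGraph {n : ℕ} (M : Matrix (Fin n) (Fin n) ℝ) (i : Fin n) :
    WeightedDigraph (Fin n) where
  weight k l :=
    if k = l then 0
    else if l = i then -M k i + ∑ m, M k m
    else -M k l
  loopless := by simp

/-! By the matrix tree theorem, `adjugate_laplacian_apply_self`, tree counts are diagonal cofactors
of Laplacians. Deleting `none` from the Laplacian of `matrixGraph M` leaves `M`, so the denominator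
is `det M`. Merging `none` into `i` multiplies `M` on the right by `S = 1 - 𝟙 eᵢᵀ`. As `adj S = 𝟙
eᵢᵀ` and `adj (M S) = adj S * adj M`, the `(j, j)` cofactor is `adj M i j`, and Cramer's rule
concludes. -/

namespace WeightedDigraph

variable {V : Type*}

/-! ### Spanning trees as parent maps -/

/-- The set of edges from each vertex other than `r` to its parent. -/
def parentEdges [Fintype V] [DecidableEq V] (r : V) (f : V → V) : Finset (V × V) :=
  (Finset.univ.erase r).image fun k => (k, f k)

theorem mem_parentEdges [Fintype V] [DecidableEq V] {r : V} {f : V → V} {u v : V} :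
    (u, v) ∈ parentEdges r f ↔ u ≠ r ∧ f u = v := by
  simp [parentEdges]

/-- `f` is the parent map of a spanning tree of `G` oriented towards `r`. -/
structure IsParentMap (G : WeightedDigraph V) (r : V) (f : V → V) : Prop where
  map_root : f r = r
  isEdge : ∀ k, k ≠ r → G.IsEdge k (f k)
  reaches : ∀ k, ∃ m, f^[m] k = r

theorem exists_iterate_of_reflTransGen {F : Finset (V × V)} {r : V} {f : V → V}
    (h : ∀ u v, (u, v) ∈ F → f u = v) {u : V}
    (hu : Relation.ReflTransGen (fun a b => (a, b) ∈ F) u r) : ∃ m, f^[m] u = r := by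
  induction hu using Relation.ReflTransGen.head_induction_on with
  | refl => exact ⟨0, rfl⟩
  | head hab _ ih =>
    obtain ⟨m, hm⟩ := ih
    exact ⟨m + 1, by rw [Function.iterate_succ_apply, h _ _ hab, hm]⟩

theorem reflTransGen_of_iterate {F : Finset (V × V)} {r : V} {f : V → V}
    (h : ∀ u, u ≠ r → (u, f u) ∈ F) (m : ℕ) (u : V) (hu : f^[m] u = r) :
    Relation.ReflTransGen (fun a b => (a, b) ∈ F) u r := by
  induction m generalizing u with
  | zero => exact hu ▸ Relation.ReflTransGen.refl
  | succ m ih =>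
    by_cases hr : u = r
    · exact hr ▸ Relation.ReflTransGen.refl
    · exact Relation.ReflTransGen.head (h u hr) (ih _ hu)

theorem IsParentMap.isSpanningTreeTowards [Fintype V] [DecidableEq V] {G : WeightedDigraph V}
    {r : V} {f : V → V} (hf : G.IsParentMap r f) :
    G.IsSpanningTreeTowards r (parentEdges r f) where
  isEdge := by
    rintro ⟨u, v⟩ h
    obtain ⟨hu, rfl⟩ := mem_parentEdges.1 h
    exact hf.isEdge u hu
  root v h := (mem_parentEdges.1 h).1 rfl
  existsUnique_out u hu :=
    ⟨f u, mem_parentEdges.2 ⟨hu, rfl⟩, fun _ h => (mem_parentEdges.1 h).2.symm⟩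
  reaches u := by
    obtain ⟨m, hm⟩ := hf.reaches u
    exact reflTransGen_of_iterate (fun u hu => mem_parentEdges.2 ⟨hu, rfl⟩) m u hm

theorem IsSpanningTreeTowards.exists_parentMap [Fintype V] [DecidableEq V] {G : WeightedDigraph V}
    {r : V} {F : Finset (V × V)} (hF : G.IsSpanningTreeTowards r F) :
    ∃ f, G.IsParentMap r f ∧ parentEdges r f = F := by
  have hex : ∀ u, ∃ v, (u = r → v = r) ∧ (u ≠ r → (u, v) ∈ F) := fun u => by
    by_cases hu : u = r
    · exact ⟨r, fun _ => rfl, fun h => absurd hu h⟩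
    · obtain ⟨v, hv, _⟩ := hF.existsUnique_out u hu
      exact ⟨v, fun h => absurd h hu, fun _ => hv⟩
  choose f hroot hmem using hex
  have hne : ∀ u v, (u, v) ∈ F → u ≠ r := by
    rintro u v h rfl
    exact hF.root v h
  have heq : ∀ u v, (u, v) ∈ F → f u = v := fun u v h =>
    (hF.existsUnique_out u (hne u v h)).unique (hmem u (hne u v h)) h
  refine ⟨f, ⟨hroot r rfl, fun k hk => hF.isEdge _ (hmem k hk),
    fun k => exists_iterate_of_reflTransGen heq (hF.reaches k)⟩, ?_⟩
  ext ⟨u, v⟩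
  rw [mem_parentEdges]
  exact ⟨fun ⟨hu, h⟩ => h ▸ hmem u hu, fun h => ⟨hne u v h, heq u v h⟩⟩

-- `parentEdges` ignores the value at `r`; the normalisation `f r = r` makes trees and parent maps
-- correspond bijectively.
open scoped Classical in
theorem treeCount_eq_sum_parentMap [Fintype V] [DecidableEq V] (G : WeightedDigraph V) (r : V) :
    G.treeCount r =
      ∑ f : V → V with G.IsParentMap r f, ∏ k ∈ Finset.univ.erase r, G.weight k (f k) := by
  symm
  unfold treeCount
  refine Finset.sum_bij (fun f _ => parentEdges r f) ?_ ?_ ?_ ?_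
  · intro f hf
    simpa using (Finset.mem_filter.1 hf).2.isSpanningTreeTowards
  · intro f hf g hg hfg
    funext k
    by_cases hk : k = r
    · rw [hk, (Finset.mem_filter.1 hf).2.map_root, (Finset.mem_filter.1 hg).2.map_root]
    · have h : (k, f k) ∈ parentEdges r g := hfg ▸ mem_parentEdges.2 ⟨hk, rfl⟩
      exact (mem_parentEdges.1 h).2.symm
  · intro F hF
    obtain ⟨f, hf, h⟩ := (Finset.mem_filter.1 hF).2.exists_parentMap
    exact ⟨f, by simpa using hf, h⟩
  · intro f _
    rw [parentEdges, Finset.prod_image]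
    intro a _ b _ h
    exact congrArg Prod.fst h

/-! ### The matrix tree theorem -/

/-- The Laplacian matrix of `G`, with weighted out-degrees on the diagonal. -/
def laplacian [Fintype V] [DecidableEq V] (G : WeightedDigraph V) : Matrix V V ℝ :=
  Matrix.diagonal (fun k => ∑ l, G.weight k l) - Matrix.of G.weight

/-- The matrix of a map `f`, with the row of `r` replaced by zero. -/
def parentMatrix [DecidableEq V] (r : V) (f : V → V) : Matrix V V ℝ :=
  Matrix.of fun k => if k = r then 0 else Pi.single (f k) 1

theorem parentMatrix_mulVec [Fintype V] [DecidableEq V] (r : V) (f : V → V) (v : V → ℝ) (k : V) :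
    (parentMatrix r f).mulVec v k = if k = r then 0 else v (f k) := by
  by_cases hk : k = r <;> simp [parentMatrix, Matrix.mulVec, hk]

/-- Each factor moves the evaluation point along `f`. The bound is strict because one more factor is
needed at `r` to hit the zero row. -/
theorem parentMatrix_pow_mulVec_eq_zero [Fintype V] [DecidableEq V] (r : V) (f : V → V)
    (v : V → ℝ) (m : ℕ) (k : V) (i : ℕ) (hi : i < m) (h : f^[i] k = r) :
    (parentMatrix r f ^ m).mulVec v k = 0 := by
  induction m generalizing k i with
  | zero => omega
  | succ m ih =>
    rw [pow_succ', ← Matrix.mulVec_mulVec, parentMatrix_mulVec]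
    split_ifs with hk
    · rfl
    · obtain _ | i := i
      · exact absurd h hk
      · exact ih (f k) i (by omega) h

/-- The parent matrix is nilpotent, so its characteristic polynomial is a power of `X`; evaluate it
at 1. -/
theorem det_one_sub_parentMatrix_of_reaches [Fintype V] [DecidableEq V] (r : V) (f : V → V)
    (h : ∀ k, ∃ m, f^[m] k = r) : (1 - parentMatrix r f).det = 1 := by
  choose m hm using h
  have hnil : IsNilpotent (parentMatrix r f) := by
    refine ⟨Finset.univ.sup m + 1, Matrix.mulVec_injective ?_⟩
    funext v k
    rw [parentMatrix_pow_mulVec_eq_zero r f v _ k (m k)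
      (Nat.lt_succ_of_le (Finset.le_sup (Finset.mem_univ k))) (hm k)]
    simp
  have hchar : (parentMatrix r f).charpoly = Polynomial.X ^ Fintype.card V :=
    sub_eq_zero.1 (Matrix.isNilpotent_charpoly_sub_pow_of_isNilpotent hnil).eq_zero
  have := Matrix.eval_charpoly (parentMatrix r f) 1
  rw [hchar] at this
  simpa using this.symm

/-- The indicator of the vertices that never reach `r` is a nonzero kernel vector. -/
theorem det_one_sub_parentMatrix_of_not_reaches [Fintype V] [DecidableEq V] (r : V) (f : V → V)
    (h : ¬ ∀ k, ∃ m, f^[m] k = r) : (1 - parentMatrix r f).det = 0 := by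
  classical
  push Not at h
  obtain ⟨k₀, hk₀⟩ := h
  let v : V → ℝ := fun k => if ∃ m, f^[m] k = r then 0 else 1
  rw [← Matrix.exists_mulVec_eq_zero_iff]
  refine ⟨v, fun hv => ?_, ?_⟩
  · have := congrFun hv k₀
    simp [v, hk₀] at this
  · funext k
    rw [Matrix.sub_mulVec, Matrix.one_mulVec, Pi.sub_apply, parentMatrix_mulVec, Pi.zero_apply,
      sub_eq_zero]
    split_ifs with hk
    · exact if_pos ⟨0, hk⟩
    · have : (∃ m, f^[m] k = r) ↔ ∃ m, f^[m] (f k) = r := by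
        refine ⟨fun ⟨m, hm⟩ => ?_, fun ⟨m, hm⟩ => ⟨m + 1, hm⟩⟩
        obtain _ | m := m
        · exact absurd hm hk
        · exact ⟨m, hm⟩
      simp only [v, this]

/-- This prepares the multilinear expansion of the determinant over all maps `f`; the coefficients
in row `r` kill those with `f r ≠ r`. -/
theorem updateRow_laplacian_apply [Fintype V] [DecidableEq V] (G : WeightedDigraph V) (r k : V) :
    G.laplacian.updateRow r (Pi.single r 1) k =
      ∑ l, (if k = r then (if l = r then 1 else 0) else G.weight k l) •
        (1 - parentMatrix r (fun _ => l)) k := by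
  funext x
  by_cases hk : k = r
  · subst hk
    simp only [Matrix.updateRow_self, if_true, parentMatrix, Finset.sum_apply, Pi.smul_apply,
      Matrix.sub_apply, Matrix.of_apply, Matrix.one_apply, Pi.single_apply, smul_eq_mul]
    simp [eq_comm]
  · simp only [Matrix.updateRow_ne hk, if_neg hk, laplacian, parentMatrix, Finset.sum_apply,
      Pi.smul_apply, Matrix.sub_apply, Matrix.of_apply, Matrix.one_apply, Matrix.diagonal_apply,
      Pi.single_apply, smul_eq_mul, mul_sub, Finset.sum_sub_distrib]
    by_cases hx : k = x <;> simp [hx]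

/-- The matrix tree theorem for weighted directed graphs. -/
theorem adjugate_laplacian_apply_self [Fintype V] [DecidableEq V] (G : WeightedDigraph V) (r : V) :
    G.laplacian.adjugate r r = G.treeCount r := by
  classical
  rw [treeCount_eq_sum_parentMap, Matrix.adjugate_apply]
  have hrow : G.laplacian.updateRow r (Pi.single r 1) = fun k =>
      ∑ l, (if k = r then (if l = r then 1 else 0) else G.weight k l) •
        (1 - parentMatrix r (fun _ => l)) k := funext (G.updateRow_laplacian_apply r)
  rw [hrow]
  change Matrix.detRowAlternating.toMultilinearMap _ = _
  rw [MultilinearMap.map_sum, Finset.sum_filter]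
  refine Finset.sum_congr rfl fun f _ => ?_
  rw [MultilinearMap.map_smul_univ]
  change _ • (1 - parentMatrix r f).det = _
  rw [← Finset.mul_prod_erase _ _ (Finset.mem_univ r),
    Finset.prod_congr rfl fun k hk => if_neg (Finset.ne_of_mem_erase hk), if_pos rfl, smul_eq_mul]
  split_ifs with hr hf hf
  · rw [det_one_sub_parentMatrix_of_reaches r f hf.reaches, one_mul, mul_one]
  -- If `f` fixes `r` but is no parent map, either it uses a non-edge or some vertex never reaches
  -- `r`.
  · by_cases hreach : ∀ k, ∃ m, f^[m] k = r
    · have : ∃ k, k ≠ r ∧ G.weight k (f k) = 0 := by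
        by_contra! hne
        exact hf ⟨hr, hne, hreach⟩
      obtain ⟨k, hk, h0⟩ := this
      rw [Finset.prod_eq_zero (Finset.mem_erase.2 ⟨hk, Finset.mem_univ k⟩) h0, mul_zero, zero_mul]
    · rw [det_one_sub_parentMatrix_of_not_reaches r f hreach, mul_zero]
  · exact absurd hf.map_root hr
  · rw [zero_mul, zero_mul]

theorem HasPositiveWeights.treeCount_nonneg [Fintype V] {G : WeightedDigraph V}
    (hG : G.HasPositiveWeights) (r : V) : 0 ≤ G.treeCount r := by
  classical
  refine Finset.sum_nonneg fun F hF => Finset.prod_nonneg fun e he => ?_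
  exact (hG _ _ ((Finset.mem_filter.1 hF).2.isEdge e he)).le

end WeightedDigraph

/-! ### The Laplacians of the two graphs -/

theorem laplacian_matrixGraph_some_some {n : ℕ} (M : Matrix (Fin n) (Fin n) ℝ) (i j : Fin n) :
    (matrixGraph M).laplacian (some i) (some j) = M i j := by
  by_cases h : i = j
  · subst h
    simp [WeightedDigraph.laplacian, matrixGraph, Fintype.sum_option, Finset.sum_ite,
      Finset.filter_ne, Finset.sum_erase_eq_sub]
  · simp [WeightedDigraph.laplacian, matrixGraph, h]

theorem treeCount_matrixGraph {n : ℕ} (M : Matrix (Fin n) (Fin n) ℝ) :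
    (matrixGraph M).treeCount none = M.det := by
  rw [← WeightedDigraph.adjugate_laplacian_apply_self, Matrix.adjugate_apply,
    ← Matrix.det_submatrix_equiv_self (Equiv.optionEquivSumPUnit.{0} (Fin n)).symm,
    ← Matrix.fromBlocks_toBlocks (Matrix.submatrix _ _ _)]
  set A := ((matrixGraph M).laplacian.updateRow none (Pi.single none 1)).submatrix
    (Equiv.optionEquivSumPUnit.{0} (Fin n)).symm (Equiv.optionEquivSumPUnit.{0} (Fin n)).symm with hA
  have h₁₁ : A.toBlocks₁₁ = M := by
    ext i j
    simp [hA, Matrix.toBlocks₁₁, laplacian_matrixGraph_some_some]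
  have h₂₁ : A.toBlocks₂₁ = 0 := by
    ext i j
    simp [hA, Matrix.toBlocks₂₁]
  have h₂₂ : A.toBlocks₂₂ = 1 := by
    ext i j
    simp [hA, Matrix.toBlocks₂₂]
  rw [h₁₁, h₂₁, h₂₂, Matrix.det_fromBlocks_zero₂₁, Matrix.det_one, mul_one]

/-- Right multiplication by this matrix subtracts the sum of each row from its `i`-th entry. -/
def subRowSum {n : ℕ} (i : Fin n) : Matrix (Fin n) (Fin n) ℝ :=
  1 - Matrix.vecMulVec 1 (Pi.single i 1)

theorem laplacian_mergedGraph {n : ℕ} (M : Matrix (Fin n) (Fin n) ℝ) (i : Fin n) :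
    (mergedGraph M i).laplacian = M * subRowSum i := by
  have hsum : ∀ k, ∑ l, (mergedGraph M i).weight k l =
      M k k - if k = i then ∑ m, M k m else 0 := fun k => by
    -- The last summand cancels the loop term at `l = k`.
    have : ∀ l, (mergedGraph M i).weight k l = (if l = i then ∑ m, M k m else 0) - M k l +
        if k = l then M k k - (if k = i then ∑ m, M k m else 0) else 0 := fun l => by
      by_cases hkl : k = l
      · subst hkl
        simp [mergedGraph]
      · by_cases hl : l = i
        · subst hl
          simp [mergedGraph, hkl]
          ring
        · simp [mergedGraph, hkl, hl]
    simp [this, Finset.sum_add_distrib]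
  ext k l
  have hright : (M * subRowSum i) k l = M k l - if l = i then ∑ m, M k m else 0 := by
    rw [subRowSum, mul_sub, mul_one, Matrix.sub_apply, Matrix.mul_vecMulVec,
      Matrix.vecMulVec_apply]
    simp [Matrix.mulVec, dotProduct, Pi.single_apply]
  rw [hright, WeightedDigraph.laplacian, Matrix.sub_apply, Matrix.diagonal_apply, hsum]
  by_cases hkl : k = l
  · subst hkl
    simp [mergedGraph]
  · by_cases hl : l = i
    · subst hl
      simp [mergedGraph, hkl]
      ring
    · simp [mergedGraph, hkl, hl]

theorem det_one_sub_vecMulVec_single {n : ℕ} (i : Fin n) (u : Fin n → ℝ) :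
    (1 - Matrix.vecMulVec u (Pi.single i 1)).det = 1 - u i := by
  have := Matrix.det_one_add_replicateCol_mul_replicateRow (ι := Unit) (-u) (Pi.single i (1 : ℝ))
  rw [← Matrix.vecMulVec_eq, Matrix.neg_vecMulVec, ← sub_eq_add_neg] at this
  rw [this]
  simp [sub_eq_add_neg]

/-- Since `det S = 0`, both products of `S` with `adj S` vanish: `S * adj S = 0` makes all rows of
`adj S` equal, and `adj S * S = 0` leaves only column `i`. One entry, `(i, i)`, remains to be
computed. -/
theorem adjugate_subRowSum {n : ℕ} (i j l : Fin n) :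
    (subRowSum i).adjugate j l = if l = i then 1 else 0 := by
  have hdet : (subRowSum i).det = 0 := by
    rw [subRowSum, det_one_sub_vecMulVec_single, Pi.one_apply, sub_self]
  split_ifs with hl
  · subst hl
    have h := congrFun (congrFun (Matrix.mul_adjugate (subRowSum l)) j) l
    rw [hdet, zero_smul, subRowSum, sub_mul, one_mul, ← subRowSum, Matrix.sub_apply,
      Matrix.zero_apply, sub_eq_zero] at h
    rw [h]
    have hself : (subRowSum l).adjugate l l = 1 := by
      have : (subRowSum l).updateRow l (Pi.single l 1) =
          1 - Matrix.vecMulVec (1 - Pi.single l 1) (Pi.single l 1) := by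
        ext a b
        by_cases ha : a = l
        · subst ha
          simp [Matrix.vecMulVec_apply, Matrix.one_apply, Pi.single_apply, eq_comm]
        · simp [Matrix.vecMulVec_apply, subRowSum, ha]
      rw [Matrix.adjugate_apply, this, det_one_sub_vecMulVec_single]
      simp
    rw [Matrix.vecMulVec_mul, Matrix.vecMulVec_apply]
    simp [hself]
  · have h := congrFun (congrFun (Matrix.adjugate_mul (subRowSum i)) j) l
    rw [hdet, zero_smul, subRowSum, mul_sub, mul_one, ← subRowSum, Matrix.sub_apply,
      Matrix.zero_apply, sub_eq_zero] at h
    rw [h]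
    rw [Matrix.mul_vecMulVec, Matrix.vecMulVec_apply]
    simp [hl]

theorem treeCount_mergedGraph {n : ℕ} (M : Matrix (Fin n) (Fin n) ℝ) (i j : Fin n) :
    (mergedGraph M i).treeCount j = M.adjugate i j := by
  rw [← WeightedDigraph.adjugate_laplacian_apply_self, laplacian_mergedGraph,
    Matrix.adjugate_mul_distrib]
  simp [Matrix.mul_apply, adjugate_subRowSum]

/-! ### Positivity and conclusion -/

theorem IsRDDL.sum_nonneg {n : ℕ} {M : Matrix (Fin n) (Fin n) ℝ} (hM : IsRDDL M) (i : Fin n) :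
    0 ≤ ∑ j, M i j := by
  have h := hM.2 i
  rw [abs_of_pos (hM.1.2 i), Finset.sum_congr rfl fun j hj =>
    abs_of_nonpos (hM.1.1 i j (Finset.ne_of_mem_erase hj).symm), Finset.sum_neg_distrib] at h
  rw [← Finset.add_sum_erase _ _ (Finset.mem_univ i)]
  linarith

theorem IsRDDL.matrixGraph_hasPositiveWeights {n : ℕ} {M : Matrix (Fin n) (Fin n) ℝ}
    (hM : IsRDDL M) : (matrixGraph M).HasPositiveWeights := by
  intro u v huv
  refine lt_of_le_of_ne ?_ (Ne.symm huv)
  rcases u with _ | i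
  · exact le_rfl
  · rcases v with _ | j
    · exact hM.sum_nonneg i
    · simp only [matrixGraph]
      split_ifs with h
      · exact le_rfl
      · exact neg_nonneg.2 (hM.1.1 i j h)

theorem IsRDDL.mergedGraph_hasPositiveWeights {n : ℕ} {M : Matrix (Fin n) (Fin n) ℝ}
    (hM : IsRDDL M) (i : Fin n) : (mergedGraph M i).HasPositiveWeights := by
  intro k l hkl
  refine lt_of_le_of_ne ?_ (Ne.symm hkl)
  simp only [mergedGraph]
  split_ifs with h hl
  · exact le_rfl
  · subst hl
    exact add_nonneg (neg_nonneg.2 (hM.1.1 k l h)) (hM.sum_nonneg k)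
  · exact neg_nonneg.2 (hM.1.1 k l h)

theorem mainTheorem5 (n : ℕ) (M : Matrix (Fin n) (Fin n) ℝ) (hM : IsRDDL M) (hinv : IsUnit M)
    (i j : Fin n) :
    (matrixGraph M).HasPositiveWeights ∧
    (mergedGraph M i).HasPositiveWeights ∧
    0 < (matrixGraph M).treeCount none ∧
    M⁻¹ i j = (mergedGraph M i).treeCount j / (matrixGraph M).treeCount none := by
  refine ⟨hM.matrixGraph_hasPositiveWeights, hM.mergedGraph_hasPositiveWeights i, ?_, ?_⟩
  -- Positive weights give only `0 ≤ det M`; invertibility makes this strict.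
  · refine lt_of_le_of_ne (hM.matrixGraph_hasPositiveWeights.treeCount_nonneg none) ?_
    rw [treeCount_matrixGraph]
    exact ((Matrix.isUnit_iff_isUnit_det M).1 hinv).ne_zero.symm
  · rw [treeCount_matrixGraph, treeCount_mergedGraph, Matrix.inv_def, Ring.inverse_eq_inv',
      Matrix.smul_apply, smul_eq_mul, div_eq_inv_mul]
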